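/- Let $\mathcal{E}^{\mathrm{adj}}$ be the walking adjoint equivalence: the (strict) $2$-category with objects $a,b$ whose underlying category is free on two morphisms $f\colon a\to b$ and $g\colon b\to a$, and whose $2$-morphisms are freely generated by invertible $2$-morphisms $\eta\colon \mathrm{id}_a\cong g\circ f$ and $\varepsilon\colon f\circ g\cong \mathrm{id}_b$, subject to the triangle identities $\varepsilon f\circ f\eta=\mathrm{id}_f$ and $g\varepsilon\circ\eta g=\mathrm{id}_g$. Let $\mathcal{C}_0$ be the terminal $2$-category (one object and only identity morphisms). A $2$-functor $F\colon\mathcal{A}\to\mathcal{B}$ is a biequivalence if every object of $\mathcal{B}$ is equivalent in $\mathcal{B}$ to one of the form $Fx$ and, for all objects $x,x'$ of $\mathcal{A}$, the functor $\mathcal{A}(x,x')\to\mathcal{B}(Fx,Fx')$ is an equivalence of categories. Proposition. The $2$-category $\mathcal{E}^{\mathrm{adj}}$ is contractible: there is a biequivalence $\mathcal{E}^{\mathrm{adj}}\to\mathcal{C}_0$. Moreover, for all objects $x,y\in\{a,b\}$, the hom-category $\mathcal{E}^{\mathrm{adj}}(x,y)$ is isomorphic, as a category, to the chaotic category $\mathrm{ch}\,\mathbb{N}$,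 whose set of objects is $\mathbb{N}$ and which has exactly one morphism between any two objects. -/

import Mathlib

open CategoryTheory Bicategory

/-! ### Equivalences in a 2-category and biequivalences of 2-categories

A (strict) 2-category is a `Bicategory` with `Bicategory.Strict`, and a 2-functor is a
`StrictPseudofunctor`. Mathlib writes composition in diagrammatic order. -/

/-- Two objects `x`, `y` of a 2-category are equivalent: there are 1-morphisms `F : x ⟶ y` and
`G : y ⟶ x` and invertible 2-morphisms `id_x ≅ G ∘ F` and `F ∘ G ≅ id_y`. -/
def AreEquivalent {B : Type*} [Bicategory B] (x y : B) : Prop :=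
  ∃ (F : x ⟶ y) (G : y ⟶ x), Nonempty (𝟙 x ≅ F ≫ G) ∧ Nonempty (G ≫ F ≅ 𝟙 y)

/-- A 2-functor is a biequivalence if it is surjective on objects up to equivalence and induces
equivalences on hom-categories. -/
structure IsBiequivalence {A B : Type*} [Bicategory A] [Bicategory B] [Bicategory.Strict A]
    [Bicategory.Strict B] (F : StrictPseudofunctor A B) : Prop where
  surj : ∀ y : B, ∃ x : A, AreEquivalent y (F.obj x)
  homEquiv : ∀ x x' : A, (F.mapFunctor x x').IsEquivalence

/-- Two 2-categories are biequivalent if there is a biequivalence between them. -/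
def Biequivalent (A B : Type*) [Bicategory A] [Bicategory B] [Bicategory.Strict A]
    [Bicategory.Strict B] : Prop :=
  ∃ F : StrictPseudofunctor A B, IsBiequivalence F

/-- The terminal 2-category `𝒞₀`: one object, and only identity 1- and 2-morphisms. -/
abbrev WalkingObject : Type := LocallyDiscrete (Discrete PUnit.{1})

/-- A 2-category is contractible if it is biequivalent to `𝒞₀`. -/
def IsContractible (A : Type*) [Bicategory A] [Bicategory.Strict A] : Prop :=
  Biequivalent A WalkingObject

/-! ### The walking adjoint equivalence -/

/-- The two objects `a` and `b`. -/
inductive WalkingVertex : Type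
  | a
  | b

/-- The two generating 1-morphisms `f : a ⟶ b` and `g : b ⟶ a`. -/
inductive WalkingArrow : WalkingVertex → WalkingVertex → Type
  | f : WalkingArrow .a .b
  | g : WalkingArrow .b .a

instance : Quiver WalkingVertex where
  Hom := WalkingArrow

/-- The walking adjoint equivalence `ℰᵃᵈʲ`, by generators and relations. Its underlying category
is the free category on `f : a ⟶ b` and `g : b ⟶ a`; its 2-morphisms are freely generated, as
those of a strict 2-category, by 2-morphisms `η : id_a ⟶ g ∘ f`, `ε : f ∘ g ⟶ id_b` and two-sided
inverses of these, subject to the two triangle identities. -/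
def WalkingAdjEquiv : Type := WalkingVertex

namespace WalkingAdjEquiv

/-- The 1-morphism `f : a ⟶ b`. -/
abbrev f : Quiver.Path WalkingVertex.a WalkingVertex.b :=
  Quiver.Hom.toPath (V := WalkingVertex) WalkingArrow.f

/-- The 1-morphism `g : b ⟶ a`. -/
abbrev g : Quiver.Path WalkingVertex.b WalkingVertex.a :=
  Quiver.Hom.toPath (V := WalkingVertex) WalkingArrow.g

/-- Formal expressions for 2-morphisms: vertical composites and whiskerings of identities and of
the generators `η`, `ε` and their formal inverses. -/
inductive Hom₂ : ∀ {x y : WalkingVertex}, Quiver.Path x y → Quiver.Path x y → Type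
  | id {x y} (p : Quiver.Path x y) : Hom₂ p p
  | vcomp {x y} {p q r : Quiver.Path x y} (θ : Hom₂ p q) (ι : Hom₂ q r) : Hom₂ p r
  | whiskerLeft {x y z} (p : Quiver.Path x y) {q r : Quiver.Path y z} (θ : Hom₂ q r) :
      Hom₂ (p.comp q) (p.comp r)
  | whiskerRight {x y z} {p q : Quiver.Path x y} (r : Quiver.Path y z) (θ : Hom₂ p q) :
      Hom₂ (p.comp r) (q.comp r)
  | η : Hom₂ Quiver.Path.nil (f.comp g)
  | ηInv : Hom₂ (f.comp g) Quiver.Path.nil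
  | ε : Hom₂ (g.comp f) Quiver.Path.nil
  | εInv : Hom₂ Quiver.Path.nil (g.comp f)

/-- The identity 2-morphism between equal 1-morphisms. -/
def Hom₂.ofEq {x y : WalkingVertex} {p q : Quiver.Path x y} (h : p = q) : Hom₂ p q :=
  h ▸ Hom₂.id p

section

local infixr:60 " ⊚ " => Hom₂.vcomp
local infixr:81 " ◃ " => Hom₂.whiskerLeft
local notation:80 θ:80 " ▹ " r:81 => Hom₂.whiskerRight r θ

/-- The relations between expressions for 2-morphisms: compatibility with vertical composition and
whiskering, the axioms of a strict 2-category (`Hom₂.ofEq` identifies the two bracketings of a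
composite 1-morphism), the invertibility of `η` and `ε`, and the two triangle identities. -/
inductive Rel : ∀ {x y : WalkingVertex} {p q : Quiver.Path x y}, Hom₂ p q → Hom₂ p q → Prop
  -- compatibility with the operations
  | vcomp_right {x y} {p q r : Quiver.Path x y} (θ : Hom₂ p q) (ι₁ ι₂ : Hom₂ q r) :
      Rel ι₁ ι₂ → Rel (θ ⊚ ι₁) (θ ⊚ ι₂)
  | vcomp_left {x y} {p q r : Quiver.Path x y} (θ₁ θ₂ : Hom₂ p q) (ι : Hom₂ q r) :
      Rel θ₁ θ₂ → Rel (θ₁ ⊚ ι) (θ₂ ⊚ ι)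
  | whiskerLeft {x y z} (p : Quiver.Path x y) (q r : Quiver.Path y z) (θ₁ θ₂ : Hom₂ q r) :
      Rel θ₁ θ₂ → Rel (p ◃ θ₁) (p ◃ θ₂)
  | whiskerRight {x y z} (p q : Quiver.Path x y) (r : Quiver.Path y z) (θ₁ θ₂ : Hom₂ p q) :
      Rel θ₁ θ₂ → Rel (θ₁ ▹ r) (θ₂ ▹ r)
  -- the 1-morphisms between two objects and the 2-morphisms between them form a category
  | id_vcomp {x y} {p q : Quiver.Path x y} (θ : Hom₂ p q) : Rel (Hom₂.id p ⊚ θ) θ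
  | vcomp_id {x y} {p q : Quiver.Path x y} (θ : Hom₂ p q) : Rel (θ ⊚ Hom₂.id q) θ
  | vcomp_assoc {x y} {p q r s : Quiver.Path x y} (θ : Hom₂ p q) (ι : Hom₂ q r) (κ : Hom₂ r s) :
      Rel ((θ ⊚ ι) ⊚ κ) (θ ⊚ ι ⊚ κ)
  -- whiskering is functorial, and the two composites of whiskerings agree
  | whiskerLeft_id {x y z} (p : Quiver.Path x y) (q : Quiver.Path y z) :
      Rel (p ◃ Hom₂.id q) (Hom₂.id (p.comp q))
  | whiskerLeft_vcomp {x y z} (p : Quiver.Path x y) {q r s : Quiver.Path y z} (θ : Hom₂ q r) (ι : Hom₂ r s) :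
      Rel (p ◃ (θ ⊚ ι)) ((p ◃ θ) ⊚ (p ◃ ι))
  | id_whiskerRight {x y z} (p : Quiver.Path x y) (q : Quiver.Path y z) :
      Rel (Hom₂.id p ▹ q) (Hom₂.id (p.comp q))
  | vcomp_whiskerRight {x y z} {p q r : Quiver.Path x y} (s : Quiver.Path y z) (θ : Hom₂ p q) (ι : Hom₂ q r) :
      Rel ((θ ⊚ ι) ▹ s) ((θ ▹ s) ⊚ (ι ▹ s))
  | whisker_exchange {x y z} {p q : Quiver.Path x y} {r s : Quiver.Path y z} (θ : Hom₂ p q) (ι : Hom₂ r s) :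
      Rel ((p ◃ ι) ⊚ (θ ▹ s)) ((θ ▹ r) ⊚ (q ◃ ι))
  -- horizontal composition is strictly unital and associative
  | nil_whiskerLeft {x y} {p q : Quiver.Path x y} (θ : Hom₂ p q) :
      Rel (Quiver.Path.nil ◃ θ) (Hom₂.ofEq p.nil_comp ⊚ θ ⊚ Hom₂.ofEq q.nil_comp.symm)
  | comp_whiskerLeft {x y z w} (p : Quiver.Path x y) (q : Quiver.Path y z) {r s : Quiver.Path z w} (θ : Hom₂ r s) :
      Rel (p.comp q ◃ θ)
        (Hom₂.ofEq (p.comp_assoc q r) ⊚ (p ◃ q ◃ θ) ⊚ Hom₂.ofEq (p.comp_assoc q s).symm)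
  | whiskerRight_nil {x y} {p q : Quiver.Path x y} (θ : Hom₂ p q) :
      Rel (θ ▹ Quiver.Path.nil) (Hom₂.ofEq p.comp_nil ⊚ θ ⊚ Hom₂.ofEq q.comp_nil.symm)
  | whiskerRight_comp {x y z w} {p q : Quiver.Path x y} (r : Quiver.Path y z) (s : Quiver.Path z w) (θ : Hom₂ p q) :
      Rel (θ ▹ (r.comp s))
        (Hom₂.ofEq (p.comp_assoc r s).symm ⊚ ((θ ▹ r) ▹ s) ⊚ Hom₂.ofEq (q.comp_assoc r s))
  | whisker_assoc {x y z w} (p : Quiver.Path x y) {q r : Quiver.Path y z} (θ : Hom₂ q r) (s : Quiver.Path z w) :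
      Rel ((p ◃ θ) ▹ s)
        (Hom₂.ofEq (p.comp_assoc q s) ⊚ (p ◃ (θ ▹ s)) ⊚ Hom₂.ofEq (p.comp_assoc r s).symm)
  -- `η` and `ε` are invertible
  | η_ηInv : Rel (Hom₂.η ⊚ Hom₂.ηInv) (Hom₂.id Quiver.Path.nil)
  | ηInv_η : Rel (Hom₂.ηInv ⊚ Hom₂.η) (Hom₂.id (f.comp g))
  | ε_εInv : Rel (Hom₂.ε ⊚ Hom₂.εInv) (Hom₂.id (g.comp f))
  | εInv_ε : Rel (Hom₂.εInv ⊚ Hom₂.ε) (Hom₂.id Quiver.Path.nil)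
  -- the triangle identities `εf ∘ fη = id_f` and `gε ∘ ηg = id_g`
  | triangle_f :
      Rel (Hom₂.ofEq f.nil_comp.symm ⊚ (Hom₂.η ▹ f) ⊚ Hom₂.ofEq (f.comp_assoc g f) ⊚
        (f ◃ Hom₂.ε) ⊚ Hom₂.ofEq f.comp_nil) (Hom₂.id f)
  | triangle_g :
      Rel (Hom₂.ofEq g.comp_nil.symm ⊚ (g ◃ Hom₂.η) ⊚ Hom₂.ofEq (g.comp_assoc f g).symm ⊚
        (Hom₂.ε ▹ g) ⊚ Hom₂.ofEq g.nil_comp) (Hom₂.id g)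

end

instance : CategoryStruct WalkingAdjEquiv where
  Hom x y := Quiver.Path (V := WalkingVertex) x y
  id x := Quiver.Path.nil (V := WalkingVertex) (a := x)
  comp p q := Quiver.Path.comp (V := WalkingVertex) p q

/-- The hom-categories: 2-morphisms are expressions modulo the relations. -/
instance homCategory (x y : WalkingAdjEquiv) : Category (x ⟶ y) where
  Hom p q := Quot (@Rel x y p q)
  id p := Quot.mk Rel (Hom₂.id p)
  comp := @fun _ _ _ => Quot.map₂ Hom₂.vcomp Rel.vcomp_right Rel.vcomp_left
  id_comp := by
    rintro p q ⟨θ⟩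
    exact Quot.sound (Rel.id_vcomp θ)
  comp_id := by
    rintro p q ⟨θ⟩
    exact Quot.sound (Rel.vcomp_id θ)
  assoc := by
    rintro p q r s ⟨θ⟩ ⟨ι⟩ ⟨κ⟩
    exact Quot.sound (Rel.vcomp_assoc θ ι κ)

theorem mk_ofEq {x y : WalkingAdjEquiv} {p q : x ⟶ y} (h : p = q) :
    (Quot.mk Rel (Hom₂.ofEq h) : p ⟶ q) = eqToHom h := by
  subst h
  rfl

/-- Left whiskering `p ◁ θ`. -/
def wl {x y z : WalkingAdjEquiv} (p : x ⟶ y) {q r : y ⟶ z} (θ : q ⟶ r) : p ≫ q ⟶ p ≫ r :=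
  Quot.map (Hom₂.whiskerLeft p) (Rel.whiskerLeft p q r) θ

/-- Right whiskering `θ ▷ r`. -/
def wr {x y z : WalkingAdjEquiv} {p q : x ⟶ y} (θ : p ⟶ q) (r : y ⟶ z) : p ≫ r ⟶ q ≫ r :=
  Quot.map (Hom₂.whiskerRight r) (Rel.whiskerRight p q r) θ

theorem wl_eqToHom {x y z : WalkingAdjEquiv} (p : x ⟶ y) {q r : y ⟶ z} (h : q = r) :
    wl p (eqToHom h) = eqToHom (h ▸ rfl) := by
  subst h
  exact Quot.sound (Rel.whiskerLeft_id p q)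

theorem wr_eqToHom {x y z : WalkingAdjEquiv} {p q : x ⟶ y} (h : p = q) (r : y ⟶ z) :
    wr (eqToHom h) r = eqToHom (h ▸ rfl) := by
  subst h
  exact Quot.sound (Rel.id_whiskerRight p r)

theorem nil_comp' {x y : WalkingAdjEquiv} (p : x ⟶ y) : 𝟙 x ≫ p = p :=
  Quiver.Path.nil_comp (V := WalkingVertex) p

theorem comp_nil' {x y : WalkingAdjEquiv} (p : x ⟶ y) : p ≫ 𝟙 y = p :=
  Quiver.Path.comp_nil (V := WalkingVertex) p

theorem comp_assoc' {x y z w : WalkingAdjEquiv} (p : x ⟶ y) (q : y ⟶ z) (r : z ⟶ w) :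
    (p ≫ q) ≫ r = p ≫ q ≫ r :=
  Quiver.Path.comp_assoc (V := WalkingVertex) p q r

/-- The 2-category structure of the walking adjoint equivalence. -/
instance bicategory : Bicategory WalkingAdjEquiv where
  homCategory := homCategory
  whiskerLeft p _ _ θ := wl p θ
  whiskerRight θ r := wr θ r
  associator p q r := eqToIso (comp_assoc' p q r)
  leftUnitor p := eqToIso (nil_comp' p)
  rightUnitor p := eqToIso (comp_nil' p)
  whiskerLeft_id p q := Quot.sound (Rel.whiskerLeft_id p q)
  whiskerLeft_comp := by
    rintro x y z p q r s ⟨θ⟩ ⟨ι⟩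
    exact Quot.sound (Rel.whiskerLeft_vcomp p θ ι)
  id_whiskerLeft := by
    rintro x y p q ⟨θ⟩
    simp only [eqToIso.hom, eqToIso.inv, ← mk_ofEq]
    exact Quot.sound (Rel.nil_whiskerLeft θ)
  comp_whiskerLeft := by
    rintro x y z w p q r s ⟨θ⟩
    simp only [eqToIso.hom, eqToIso.inv, ← mk_ofEq]
    exact Quot.sound (Rel.comp_whiskerLeft p q θ)
  id_whiskerRight p q := Quot.sound (Rel.id_whiskerRight p q)
  comp_whiskerRight := by
    rintro x y z p q r ⟨θ⟩ ⟨ι⟩ s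
    exact Quot.sound (Rel.vcomp_whiskerRight s θ ι)
  whiskerRight_id := by
    rintro x y p q ⟨θ⟩
    simp only [eqToIso.hom, eqToIso.inv, ← mk_ofEq]
    exact Quot.sound (Rel.whiskerRight_nil θ)
  whiskerRight_comp := by
    rintro x y z w p q ⟨θ⟩ r s
    simp only [eqToIso.hom, eqToIso.inv, ← mk_ofEq]
    exact Quot.sound (Rel.whiskerRight_comp r s θ)
  whisker_assoc := by
    rintro x y z w p q r ⟨θ⟩ s
    simp only [eqToIso.hom, eqToIso.inv, ← mk_ofEq]
    exact Quot.sound (Rel.whisker_assoc p θ s)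
  whisker_exchange := by
    rintro x y z p q r s ⟨θ⟩ ⟨ι⟩
    exact Quot.sound (Rel.whisker_exchange θ ι)
  pentagon p q r s := by
    simp only [eqToIso.hom, wl_eqToHom, wr_eqToHom, eqToHom_trans]
  triangle p q := by
    simp only [eqToIso.hom, wl_eqToHom, wr_eqToHom, eqToHom_trans]

instance strict : Bicategory.Strict WalkingAdjEquiv where
  id_comp := nil_comp'
  comp_id := comp_nil'
  assoc := comp_assoc'
  leftUnitor_eqToIso _ := rfl
  rightUnitor_eqToIso _ := rfl
  associator_eqToIso _ _ _ := rfl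

end WalkingAdjEquiv

namespace WalkingAdjEquiv

/-! Fix an object x. Deleting generators one at a time by unitors, `η⁻¹` or `ε` contracts `shortest
x y ≫ q` to `shortest x z`, for every q from y to z; this is `collapse`. Every 2-morphism commutes
with these contractions (`shortest_whiskerLeft`): the property is stable under all operations, and
on `η` and `ε` it is the definition of `collapse` or a triangle identity. When x is the source of q,
`shortest x x` is an identity, so a 2-morphism is determined by its source and target, while
`collapse` itself provides one between any parallel pair. The hom-categories are thus chaotic, with
countably many objects because a path is determined by its endpoints and its length. -/

/-- The object `a`. -/
abbrev objA : WalkingAdjEquiv := WalkingVertex.a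

/-- The object `b`. -/
abbrev objB : WalkingAdjEquiv := WalkingVertex.b

/-- The 1-morphism `f`, seen in the 2-category. -/
abbrev homF : objA ⟶ objB := f

/-- The 1-morphism `g`, seen in the 2-category. -/
abbrev homG : objB ⟶ objA := g

/-- The unit `η` as an invertible 2-morphism. -/
def unitIso : 𝟙 objA ≅ homF ≫ homG where
  hom := Quot.mk Rel Hom₂.η
  inv := Quot.mk Rel Hom₂.ηInv
  hom_inv_id := Quot.sound Rel.η_ηInv
  inv_hom_id := Quot.sound Rel.ηInv_η

/-- The counit `ε` as an invertible 2-morphism. -/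
def counitIso : homG ≫ homF ≅ 𝟙 objB where
  hom := Quot.mk Rel Hom₂.ε
  inv := Quot.mk Rel Hom₂.εInv
  hom_inv_id := Quot.sound Rel.ε_εInv
  inv_hom_id := Quot.sound Rel.εInv_ε

theorem left_triangle :
    (λ_ homF).inv ≫ unitIso.hom ▷ homF ≫ (α_ homF homG homF).hom ≫
      homF ◁ counitIso.hom ≫ (ρ_ homF).hom = 𝟙 homF :=
  Quot.sound Rel.triangle_f

theorem right_triangle :
    (ρ_ homG).inv ≫ homG ◁ unitIso.hom ≫ (α_ homG homF homG).inv ≫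
      counitIso.hom ▷ homG ≫ (λ_ homG).hom = 𝟙 homG :=
  Quot.sound Rel.triangle_g

/-! ### Contracting 1-morphisms to shortest ones -/

/-- The shortest 1-morphism between two objects. -/
def shortest : ∀ x y : WalkingAdjEquiv, x ⟶ y
  | .a, .a => 𝟙 objA
  | .a, .b => homF
  | .b, .a => homG
  | .b, .b => 𝟙 objB

/-- A generating 1-morphism, seen in the 2-category. -/
abbrev ofArrow {y z : WalkingAdjEquiv} (e : WalkingArrow y z) : y ⟶ z :=
  Quiver.Hom.toPath (V := WalkingVertex) e

/-- Induction on 1-morphisms: they are composites of generators. -/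
theorem hom_induction {y : WalkingAdjEquiv} {motive : ∀ {z : WalkingAdjEquiv}, (y ⟶ z) → Prop}
    (id : motive (𝟙 y))
    (comp : ∀ {z w : WalkingAdjEquiv} (q : y ⟶ z) (e : WalkingArrow z w),
      motive q → motive (q ≫ ofArrow e)) : ∀ {z : WalkingAdjEquiv} (q : y ⟶ z), motive q
  | _, .nil => id
  | _, .cons q e => comp q e (hom_induction id comp q)

/-- Composing a shortest 1-morphism with a generator gives a shortest 1-morphism, up to the unit
or the counit. -/
def collapseArrow : ∀ (x : WalkingAdjEquiv) {y z : WalkingAdjEquiv} (e : WalkingArrow y z),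
    shortest x y ≫ ofArrow e ≅ shortest x z
  | .a, _, _, .f => λ_ homF
  | .a, _, _, .g => unitIso.symm
  | .b, _, _, .f => counitIso
  | .b, _, _, .g => λ_ homG

/-- The inductive step in the construction of `collapse`. -/
def collapseCons (x : WalkingAdjEquiv) {y z w : WalkingAdjEquiv} (q : y ⟶ z)
    (e : WalkingArrow z w) (i : shortest x y ≫ q ≅ shortest x z) :
    shortest x y ≫ q ≫ ofArrow e ≅ shortest x w :=
  (α_ _ q (ofArrow e)).symm ≪≫ whiskerRightIso i (ofArrow e) ≪≫ collapseArrow x e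

/-- The composite of a shortest 1-morphism with any 1-morphism is isomorphic to a shortest one. -/
def collapse (x : WalkingAdjEquiv) {y : WalkingAdjEquiv} :
    ∀ {z : WalkingAdjEquiv} (q : y ⟶ z), shortest x y ≫ q ≅ shortest x z
  | _, .nil => ρ_ _
  | _, .cons q e => collapseCons x q e (collapse x q)

theorem collapse_id (x y : WalkingAdjEquiv) : collapse x (𝟙 y) = ρ_ (shortest x y) := rfl

theorem collapse_comp_ofArrow (x : WalkingAdjEquiv) {y z w : WalkingAdjEquiv}
    (q : y ⟶ z) (e : WalkingArrow z w) :
    (collapse x (q ≫ ofArrow e)).hom =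
      (α_ _ q (ofArrow e)).inv ≫ (collapse x q).hom ▷ ofArrow e ≫ (collapseArrow x e).hom :=
  rfl

theorem collapse_ofArrow (x : WalkingAdjEquiv) {z w : WalkingAdjEquiv} (e : WalkingArrow z w) :
    (collapse x (ofArrow e)).hom = (collapseArrow x e).hom := by
  refine (collapse_comp_ofArrow x (𝟙 _) e).trans ?_
  rw [collapse_id, triangle_assoc_comp_right_assoc]
  -- The remaining left unitor is `eqToIso` of an equality that holds definitionally, hence an
  -- identity.
  exact (congrArg (· ≫ _) (Bicategory.whiskerLeft_id _ _)).trans (Category.id_comp _)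

/-- Contraction consumes a path from its start, so p is used up before q; the induction is on q
because `collapse` recurses on the last arrow. -/
theorem collapse_comp (x : WalkingAdjEquiv) {y z w : WalkingAdjEquiv} (p : y ⟶ z) (q : z ⟶ w) :
    (collapse x (p ≫ q)).hom =
      (α_ _ p q).inv ≫ (collapse x p).hom ▷ q ≫ (collapse x q).hom := by
  induction q using hom_induction with
  | id =>
    change (collapse x p).hom =
      (α_ _ p (𝟙 _)).inv ≫ (collapse x p).hom ▷ (𝟙 _) ≫ (ρ_ (shortest x z)).hom
    rw [rightUnitor_naturality, ← Category.assoc, rightUnitor_comp, Iso.inv_hom_id_assoc]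
    exact ((congrArg (· ≫ _) (Bicategory.whiskerLeft_id _ _)).trans (Category.id_comp _)).symm
  | @comp u v q e ih =>
    have h := collapse_comp_ofArrow x (p ≫ q) e
    -- Both bracketings are the same path by definition, so the whiskered associator inserted here
    -- is an identity; it is there to let `simp` apply coherence.
    have key : shortest x y ◁ (α_ p q (ofArrow e)).hom ≫
        (α_ _ p (q ≫ ofArrow e)).inv ≫ (collapse x p).hom ▷ (q ≫ ofArrow e) ≫
          (collapse x (q ≫ ofArrow e)).hom = (collapse x ((p ≫ q) ≫ ofArrow e)).hom := by
      rw [h, ih, collapse_comp_ofArrow]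
      simp
    exact key.symm.trans
      ((congrArg (· ≫ _) (Bicategory.whiskerLeft_id _ _)).trans (Category.id_comp _))

/-! ### Naturality of the contraction -/

/-- From a, `f` then `g` contracts by `η⁻¹`, which cancels `η`; from b it contracts by `ε`, and the
claim is the triangle identity for `g`. -/
theorem shortest_whiskerLeft_unit (x : WalkingAdjEquiv) :
    shortest x objA ◁ unitIso.hom ≫ (collapse x (homF ≫ homG)).hom =
      (collapse x (𝟙 objA)).hom := by
  rw [collapse_comp, collapse_ofArrow x WalkingArrow.f, collapse_ofArrow x WalkingArrow.g,
    collapse_id]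
  cases x
  · change 𝟙 objA ◁ unitIso.hom ≫ (α_ (𝟙 objA) homF homG).inv ≫ (λ_ homF).hom ▷ homG ≫
      unitIso.inv = (ρ_ (𝟙 objA)).hom
    simp
  · change homG ◁ unitIso.hom ≫ (α_ homG homF homG).inv ≫ counitIso.hom ▷ homG ≫
      (λ_ homG).hom = (ρ_ homG).hom
    rw [← cancel_epi (ρ_ homG).inv, right_triangle, Iso.inv_hom_id]

/-- Dual to the unit: the triangle identity for `f` is needed from a, while from b both sides
contract by `ε`. -/
theorem shortest_whiskerLeft_counit (x : WalkingAdjEquiv) :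
    shortest x objB ◁ counitIso.hom ≫ (collapse x (𝟙 objB)).hom =
      (collapse x (homG ≫ homF)).hom := by
  rw [collapse_comp, collapse_ofArrow x WalkingArrow.f, collapse_ofArrow x WalkingArrow.g,
    collapse_id]
  cases x
  · change homF ◁ counitIso.hom ≫ (ρ_ homF).hom = (α_ homF homG homF).inv ≫
      unitIso.inv ▷ homF ≫ (λ_ homF).hom
    have h := left_triangle
    replace h := ((Iso.inv_comp_eq _).1 h).trans (Category.comp_id (λ_ homF).hom)
    rw [← h]
    simp
  · change 𝟙 objB ◁ counitIso.hom ≫ (ρ_ (𝟙 objB)).hom = (α_ (𝟙 objB) homG homF).inv ≫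
      (λ_ homG).hom ▷ homF ≫ counitIso.hom
    simp

/-- Collapsing is natural with respect to a 2-morphism. -/
def CollapseNatural {y z : WalkingAdjEquiv} {p q : y ⟶ z} (θ : p ⟶ q) : Prop :=
  ∀ x : WalkingAdjEquiv, shortest x y ◁ θ ≫ (collapse x q).hom = (collapse x p).hom

namespace CollapseNatural

variable {y z w : WalkingAdjEquiv}

theorem id (p : y ⟶ z) : CollapseNatural (𝟙 p) := fun x => by simp

theorem comp {p q r : y ⟶ z} {θ : p ⟶ q} {ι : q ⟶ r} (hθ : CollapseNatural θ)
    (hι : CollapseNatural ι) : CollapseNatural (θ ≫ ι) := fun x => by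
  rw [Bicategory.whiskerLeft_comp, Category.assoc, hι, hθ]

/-- Interchange moves θ past the contraction of p, leaving θ whiskered by `shortest x z`. Hence
naturality is needed for shortest paths that are not identities. -/
theorem whiskerLeft (p : y ⟶ z) {q r : z ⟶ w} {θ : q ⟶ r} (hθ : CollapseNatural θ) :
    CollapseNatural (p ◁ θ) := fun x => by
  rw [collapse_comp, collapse_comp, ← hθ x]
  rw [associator_inv_naturality_right_assoc, whisker_exchange_assoc]

theorem whiskerRight {p q : y ⟶ z} {θ : p ⟶ q} (r : z ⟶ w) (hθ : CollapseNatural θ) :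
    CollapseNatural (θ ▷ r) := fun x => by
  rw [collapse_comp, collapse_comp, ← hθ x]
  simp

theorem inv {p q : y ⟶ z} {i : p ≅ q} (h : CollapseNatural i.hom) : CollapseNatural i.inv :=
  fun x => by rw [← h x, whiskerLeft_inv_hom_assoc]

/-- Naturality is a property of classes of expressions, so induction on expressions suffices and no
relation has to be checked. -/
theorem mk : ∀ {y z : WalkingVertex} {p q : Quiver.Path y z} (θ : Hom₂ p q),
    @CollapseNatural y z p q (Quot.mk Rel θ)
  | _, _, _, _, .id p => id p
  | _, _, _, _, .vcomp θ ι => comp (mk θ) (mk ι)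
  | _, _, _, _, .whiskerLeft p θ => whiskerLeft p (mk θ)
  | _, _, _, _, .whiskerRight r θ => whiskerRight r (mk θ)
  | _, _, _, _, .η => shortest_whiskerLeft_unit
  | _, _, _, _, .ηInv => inv (i := unitIso) shortest_whiskerLeft_unit
  | _, _, _, _, Hom₂.ε => shortest_whiskerLeft_counit
  | _, _, _, _, .εInv => inv (i := counitIso) shortest_whiskerLeft_counit

end CollapseNatural

/-! ### Hom-categories are chaotic -/

theorem shortest_whiskerLeft (x : WalkingAdjEquiv) {y z : WalkingAdjEquiv} {p q : y ⟶ z}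
    (θ : p ⟶ q) : shortest x y ◁ θ ≫ (collapse x q).hom = (collapse x p).hom := by
  obtain ⟨θ, rfl⟩ := Quot.exists_rep θ
  exact CollapseNatural.mk θ x

theorem shortest_self (x : WalkingAdjEquiv) : shortest x x = 𝟙 x := by
  cases x <;> rfl

/-- There is at most one 2-morphism between two 1-morphisms. -/
instance subsingleton_hom₂ {x y : WalkingAdjEquiv} (p q : x ⟶ y) : Subsingleton (p ⟶ q) where
  allEq θ ι := by
    have h : shortest x x ◁ θ = shortest x x ◁ ι := by
      rw [← cancel_mono (collapse x q).hom, shortest_whiskerLeft, shortest_whiskerLeft]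
    rw [shortest_self] at h
    exact (whiskerLeft_iff θ ι).1 h

/-- Every 1-morphism is isomorphic to a shortest one. -/
def isoShortest {x y : WalkingAdjEquiv} (p : x ⟶ y) : p ≅ shortest x y :=
  (λ_ p).symm ≪≫ whiskerRightIso (eqToIso (shortest_self x).symm) p ≪≫ collapse x p

instance nonempty_hom₂ {x y : WalkingAdjEquiv} (p q : x ⟶ y) : Nonempty (p ⟶ q) :=
  ⟨((isoShortest p) ≪≫ (isoShortest q).symm).hom⟩

/-! ### Counting 1-morphisms -/

/-- Each vertex is the target of exactly one generator, so the last arrow of a nonempty path is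
forced by its endpoint. -/
theorem eq_of_length_eq {x : WalkingVertex} :
    ∀ {y : WalkingVertex} {p q : Quiver.Path x y}, p.length = q.length → p = q
  | _, .nil, .nil, _ => rfl
  | _, .cons _ .f, .cons _ .f, h => congrArg (·.cons .f) (eq_of_length_eq (Nat.succ.inj h))
  | _, .cons _ .g, .cons _ .g, h => congrArg (·.cons .g) (eq_of_length_eq (Nat.succ.inj h))

instance countable_hom (x y : WalkingAdjEquiv) : Countable (x ⟶ y) :=
  Function.Injective.countable (f := fun p : Quiver.Path (V := WalkingVertex) x y => p.length)
    fun _ _ => eq_of_length_eq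

/-- Every object has a 1-morphism to itself of length two. -/
theorem exists_loop (y : WalkingVertex) : ∃ l : Quiver.Path y y, l.length = 2 := by
  cases y
  · exact ⟨f.comp g, rfl⟩
  · exact ⟨g.comp f, rfl⟩

instance infinite_hom (x y : WalkingAdjEquiv) : Infinite (x ⟶ y) := by
  obtain ⟨l, hl⟩ := exists_loop y
  let powers : ℕ → Quiver.Path (V := WalkingVertex) x y :=
    fun n => Nat.rec (shortest x y) (fun _ p => p.comp l) n
  have hlen (n : ℕ) : (powers (n + 1)).length = (powers n).length + 2 := by
    rw [← hl]
    exact Quiver.Path.length_comp _ _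
  have hmono : StrictMono fun n => (powers n).length :=
    strictMono_nat_of_lt_succ fun n => by rw [hlen]; omega
  exact Infinite.of_injective powers fun m n h => hmono.injective (congrArg Quiver.Path.length h)

/-! ### Contractibility -/

/-- The 2-functor to the terminal 2-category. -/
def toWalkingObject : StrictPseudofunctor WalkingAdjEquiv WalkingObject :=
  StrictPseudofunctor.mk''
    { obj _ := ⟨⟨PUnit.unit⟩⟩
      map _ := 𝟙 _
      map₂ _ := 𝟙 _
      map_id _ := rfl
      map_comp _ _ := rfl
      map₂_id _ := rfl
      map₂_comp _ _ := Subsingleton.elim _ _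
      map₂_whisker_left _ _ _ _ := Subsingleton.elim _ _
      map₂_whisker_right _ _ := Subsingleton.elim _ _ }

instance subsingleton_walkingObject_hom (x y : WalkingObject) : Subsingleton (x ⟶ y) where
  allEq _ _ := Discrete.ext (Subsingleton.elim _ _)

theorem isBiequivalence_toWalkingObject : IsBiequivalence toWalkingObject where
  surj := by
    rintro ⟨⟨⟨⟩⟩⟩
    exact ⟨objA, 𝟙 _, 𝟙 _, ⟨(λ_ _).symm⟩, ⟨λ_ _⟩⟩
  homEquiv x y :=
    { faithful := ⟨fun _ => Subsingleton.elim _ _⟩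
      full := ⟨fun _ => ⟨Classical.arbitrary _, Subsingleton.elim _ _⟩⟩
      essSurj := ⟨fun _ => ⟨shortest x y, ⟨eqToIso (Subsingleton.elim _ _)⟩⟩⟩ }

end WalkingAdjEquiv

/-- A category with exactly one morphism between any two objects is isomorphic to the codiscrete
category on any type equivalent to its type of objects. -/
noncomputable def CategoryTheory.Cat.isoCodiscrete {C α : Type} [Category.{0} C]
    [∀ p q : C, Subsingleton (p ⟶ q)] [∀ p q : C, Nonempty (p ⟶ q)] (e : C ≃ α) :
    Cat.of C ≅ Cat.of (Codiscrete α) where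
  hom := (Codiscrete.functor e).toCatHom
  inv := Functor.toCatHom
    { obj n := e.symm n.as
      map _ := Classical.arbitrary _
      map_id _ := Subsingleton.elim _ _
      map_comp _ _ := Subsingleton.elim _ _ }
  hom_inv_id := Cat.ext (Functor.ext (fun p => e.symm_apply_apply p)
    fun _ _ _ => Subsingleton.elim (α := (_ : C) ⟶ _) _ _)
  inv_hom_id := Cat.ext (Functor.ext (fun n => congrArg Codiscrete.mk (e.apply_symm_apply n.as))
    fun _ _ _ => rfl)

theorem mainTheorem9 :
    IsContractible WalkingAdjEquiv ∧
      ∀ x y : WalkingAdjEquiv, Nonempty (Cat.of (x ⟶ y) ≅ Cat.of (Codiscrete ℕ)) := by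
  refine ⟨⟨_, WalkingAdjEquiv.isBiequivalence_toWalkingObject⟩, fun x y => ?_⟩
  obtain ⟨_⟩ := nonempty_denumerable (x ⟶ y)
  exact ⟨Cat.isoCodiscrete (Denumerable.eqv (x ⟶ y))⟩
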